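/- A temporal graph $\mathcal G=(V,E,\lambda)$ is a graph $(V,E)$ with a finite set $\lambda(e)$ of positive real time labels on each edge $e\in E$. Let $H=(V_H,E_H)$ be a fixed finite simple graph with $|E_H|\ge 2$ and let $P=(E_H,\prec)$ be a strict partial order on its edges; $\mathrm{height}(P)$ is the largest number of elements of a chain of $P$. For real $\delta$, $\mathcal G$ contains $(H,P)$ as a $\delta$-temporal motif if there are a subgraph $(V',E')$ of $(V,E)$, a choice of one label $\lambda'(e)\in\lambda(e)$ for each $e\in E'$, and a graph isomorphism $\Phi:H\to(V',E')$ such that $\lambda'(\Phi(e))<\lambda'(\Phi(f))$ whenever $e\prec f$ in $P$, and $\lambda'(e_1)-\lambda'(e_2)<\delta$ for all $e_1,e_2\in E'$. Put $$\rho_H=\min\left\{\frac{|V_I|}{|E_I|-1}\;:\; I\subseteq H \text{ a subgraph with } |E_I|\ge 2\right\}.$$ Let $\psi$ be a probability distribution on $\{0,1,2,\dots\}$ with positive and finite first and second moments. For a positive integer $T$, the random temporal graph $\Gamma_{[n]}(\psi,T)$ on the vertex set $[n]=\{1,\dots,n\}$ is obtained by taking, independently for each edge $e\in\binom{[n]}{2}$,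 a number $l_e\sim\psi$ and letting $\lambda(e)$ be the set of values of $l_e$ independent samples, each uniform on $\{1,\dots,T\}$. **Theorem.** Let $\beta:\mathbb N\to\mathbb N$ and $T:\mathbb N\to\{1,2,\dots\}$ be functions such that $\beta(n)\le T(n)$ for all $n$, and such that there is $n_0>0$ with $\beta(n)\ge\mathrm{height}(P)$ for all $n\ge n_0$. Then, as $n\to\infty$: 1. if $\beta(n)/T(n)=\omega(n^{-\rho_H})$, the probability that a sample of $\Gamma_{[n]}(\psi,T(n))$ contains $(H,P)$ as a $\beta(n)$-temporal motif tends to $1$; 2. if $\beta(n)/T(n)=o(n^{-\rho_H})$, the probability that a sample of $\Gamma_{[n]}(\psi,T(n))$ does not contain $(H,P)$ as a $\beta(n)$-temporal motif tends to $1$. -/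

import Mathlib

open Filter Topology Asymptotics MeasureTheory
open scoped ENNReal

/-- A temporal graph on the vertex set `V`: an underlying static graph, together with a finite set
of positive real time labels on each edge. -/
structure TemporalGraph (V : Type*) where
  graph : SimpleGraph V
  labels : graph.edgeSet → Finset ℝ
  labels_pos : ∀ e, ∀ t ∈ labels e, 0 < t

namespace TemporalGraph

/-- `G` contains `(H, P)` as a `δ`-temporal motif, where `P` is a strict order on the edges of `H`:
there are a subgraph `S` of the underlying graph, a choice `lab` of one label of `G` for each edge
of `S`, and an isomorphism `Φ` from `H` onto `S`, such that the chosen labels realize `P`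
and any two of them differ by less than `δ`. -/
def ContainsMotif {V W : Type*} (G : TemporalGraph V) (H : SimpleGraph W)
    (P : H.edgeSet → H.edgeSet → Prop) (δ : ℝ) : Prop :=
  ∃ (S : G.graph.Subgraph) (lab : S.coe.edgeSet → ℝ) (Φ : H ≃g S.coe),
    (∀ e, lab e ∈ G.labels (S.hom.mapEdgeSet e)) ∧
    (∀ e f : H.edgeSet, P e f → lab (Φ.mapEdgeSet e) < lab (Φ.mapEdgeSet f)) ∧
    (∀ e f : S.coe.edgeSet, lab e - lab f < δ)

/-- The temporal graph on the complete graph with prescribed (possibly empty) sets of positive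
integer labels on the edges. -/
noncomputable def ofLabels {V : Type*}
    (L : (⊤ : SimpleGraph V).edgeSet → Finset ℕ+) : TemporalGraph V where
  graph := ⊤
  labels e := (L e).image fun t : ℕ+ => ((t : ℕ) : ℝ)
  labels_pos := by
    intro e t ht
    obtain ⟨s, -, rfl⟩ := Finset.mem_image.mp ht
    exact Nat.cast_pos.mpr s.pos

/-- Every set of temporal graphs is an event. -/
instance instMeasurableSpace (V : Type*) : MeasurableSpace (TemporalGraph V) := ⊤

end TemporalGraph

/-- The sparsity `ρ_H`: the minimum of `|V_I| / (|E_I| - 1)` over the subgraphs `I` of `H` with at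
least two edges. For a finite graph with at least two edges this is an infimum over a finite
nonempty set. -/
noncomputable def sparsity {W : Type*} (H : SimpleGraph W) : ℝ :=
  sInf {x : ℝ | ∃ I : H.Subgraph, 2 ≤ I.edgeSet.ncard ∧
    x = (I.verts.ncard : ℝ) / ((I.edgeSet.ncard : ℝ) - 1)}

/-- The moment `E[Q ^ j]` of `Q ∼ ψ`, as an extended nonnegative real. -/
noncomputable def labelMoment (ψ : PMF ℕ) (j : ℕ) : ℝ≥0∞ :=
  ∑' k : ℕ, ψ k * (k : ℝ≥0∞) ^ j

/-- A label multiplicity distribution: a distribution on the nonnegative integers with positive and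
finite first and second moments. -/
def IsLabelMultiplicity (ψ : PMF ℕ) : Prop :=
  (0 < labelMoment ψ 1 ∧ labelMoment ψ 1 < ⊤) ∧ (0 < labelMoment ψ 2 ∧ labelMoment ψ 2 < ⊤)

/-- The uniform distribution on `{1, …, T}`. -/
noncomputable def uniformLabel (T : ℕ+) : PMF ℕ+ :=
  PMF.uniformOfFinset (Finset.Icc 1 T) ⟨1, Finset.mem_Icc.mpr ⟨le_rfl, one_le⟩⟩

/-- The law of the set of values of `k` independent samples, each uniform on `{1, …, T}`. -/
noncomputable def drawLabels (T : ℕ+) : ℕ → PMF (Finset ℕ+)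
  | 0 => PMF.pure ∅
  | k + 1 => (uniformLabel T).bind fun t => (drawLabels T k).map fun s => insert t s

/-- The law of the label set of one edge: the number of samples is drawn from `ψ`, then that many
independent labels are drawn uniformly from `{1, …, T}`. -/
noncomputable def edgeLaw (ψ : PMF ℕ) (T : ℕ+) : PMF (Finset ℕ+) :=
  ψ.bind (drawLabels T)

/-- The law `Γ_V(ψ, T)` of the discrete doubly random temporal graph: the label sets of the
two-element subsets of `V` are independent, each with law `edgeLaw ψ T`. -/
noncomputable def doublyRandom (V : Type*) [Fintype V] [DecidableEq V] (ψ : PMF ℕ) (T : ℕ+) :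
    Measure (TemporalGraph V) :=
  (Measure.pi fun _ : (⊤ : SimpleGraph V).edgeSet => (edgeLaw ψ T).toMeasure).map
    TemporalGraph.ofLabels

/-! Write p = β/T, and let H have v vertices and e edges. For a fixed injection of the vertices, one
edge may take any label and the others must land within β of it, so a motif there costs about
p^(e-1), and about n^v p^(e-1) motifs are expected.

Absence is a first moment argument. `pi_containsMotif_le` is applied to a subgraph I attaining ρ =
ρ_H, with the order forgotten. Since ρ(|E_I| - 1) = |V_I|, the bound is a constant times (p
n^ρ)^(|E_I|-1), which tends to 0 when p = o(n^(-ρ)).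

Presence is a second moment argument on more rigid events. The labels are cut into K = ⌊T/β⌋ blocks
of length β, and each block into height(P) sub-windows. Edge f must have a label in the sub-window
given by its rank in P, which forces both the order and the spread. Each such event has probability
at least a constant times p^e. As K is of order 1/p, the mean is at least a constant times n^v
p^(e-1). Pairs sharing no edge are independent. If exactly the edges in J are shared, touching u
vertices, there are O(n^(2v-u)) pairs of injections. Each costs O(p^(2e-|J|)) in a common block and
O(p^(2e)) in different blocks, the latter because distinct samples must hit disjoint windows; this
uses the second moment of ψ. Divided by the square of the mean, the total is O(1/(n^u p^(|J|-1)) +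
1/n^u) for each J. By the minimality of ρ, u ≥ ρ(|J| - 1), so all terms vanish when p = ω(n^(-ρ)).
The bound is `exists_pi_not_containsMotif_le`. -/

/-! ### The label set of a single edge -/

/-- The event that a label set meets `A`. -/
def hitting (A : Finset ℕ+) : Set (Finset ℕ+) := {s | ∃ t ∈ s, t ∈ A}

theorem not_hitting_empty (A : Finset ℕ+) : ∅ ∉ hitting A := by simp [hitting]

theorem insert_mem_hitting {A : Finset ℕ+} {t : ℕ+} {s : Finset ℕ+} :
    insert t s ∈ hitting A ↔ t ∈ A ∨ s ∈ hitting A := by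
  simp [hitting]

theorem drawLabels_succ_apply (T : ℕ+) (k : ℕ) (D : Set (Finset ℕ+)) :
    (drawLabels T (k + 1)).toMeasure D =
      ∑' t, uniformLabel T t * (drawLabels T k).toMeasure {s | insert t s ∈ D} := by
  rw [drawLabels, PMF.toMeasure_bind_apply _ _ _ (Set.to_countable _).measurableSet]
  refine tsum_congr fun t => ?_
  rw [PMF.toMeasure_map_apply _ _ _ (measurable_of_countable _) (Set.to_countable _).measurableSet]
  rfl

theorem sum_uniformLabel_eq_tsum (T : ℕ+) (A : Finset ℕ+) :
    ∑ t ∈ A, uniformLabel T t = ∑' t, uniformLabel T t * (A : Set ℕ+).indicator 1 t := by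
  rw [tsum_eq_sum (s := A) fun t ht => by simp [ht]]
  exact Finset.sum_congr rfl fun t ht => by simp [ht]

/-- Union bound over the k samples, peeled off one at a time. -/
theorem drawLabels_hitting_le (T : ℕ+) (k : ℕ) (A : Finset ℕ+) :
    (drawLabels T k).toMeasure (hitting A) ≤ k * (∑ t ∈ A, uniformLabel T t) := by
  induction k with
  | zero =>
    rw [drawLabels, PMF.toMeasure_pure_apply _ _ (Set.to_countable _).measurableSet]
    simp [not_hitting_empty]
  | succ k ih =>
    rw [drawLabels_succ_apply]
    calc ∑' t, uniformLabel T t * (drawLabels T k).toMeasure {s | insert t s ∈ hitting A}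
        ≤ ∑' t, (uniformLabel T t * (A : Set ℕ+).indicator 1 t
            + uniformLabel T t * (drawLabels T k).toMeasure (hitting A)) := by
          refine ENNReal.tsum_le_tsum fun t => ?_
          rw [← mul_add]
          gcongr
          by_cases ht : t ∈ A
          · simpa [ht] using prob_le_one.trans le_self_add
          · simp [ht, insert_mem_hitting]
      _ = (∑ t ∈ A, uniformLabel T t) + (drawLabels T k).toMeasure (hitting A) := by
          rw [ENNReal.tsum_add, ENNReal.tsum_mul_right, PMF.tsum_coe, one_mul,
            sum_uniformLabel_eq_tsum]
      _ ≤ _ := by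
          rw [Nat.cast_succ, add_mul, one_mul, add_comm]
          gcongr

/-- One sample cannot hit both sets, so two different samples must: there are k(k-1) ordered
choices, rounded up to k². Averaging over k then produces the second moment of ψ. -/
theorem drawLabels_hitting_inter_le (T : ℕ+) (k : ℕ) {A B : Finset ℕ+} (hAB : Disjoint A B) :
    (drawLabels T k).toMeasure (hitting A ∩ hitting B) ≤
      (k : ℝ≥0∞) ^ 2 * ((∑ t ∈ A, uniformLabel T t) * (∑ t ∈ B, uniformLabel T t)) := by
  induction k with
  | zero =>
    rw [drawLabels, PMF.toMeasure_pure_apply _ _ (Set.to_countable _).measurableSet]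
    simp [not_hitting_empty]
  | succ k ih =>
    rw [drawLabels_succ_apply]
    set a := (∑ t ∈ A, uniformLabel T t) with ha
    set b := (∑ t ∈ B, uniformLabel T t) with hb
    calc ∑' t, uniformLabel T t *
          (drawLabels T k).toMeasure {s | insert t s ∈ hitting A ∩ hitting B}
        ≤ ∑' t, (uniformLabel T t * (A : Set ℕ+).indicator 1 t *
              (drawLabels T k).toMeasure (hitting B)
            + uniformLabel T t * (B : Set ℕ+).indicator 1 t *
              (drawLabels T k).toMeasure (hitting A)
            + uniformLabel T t * (drawLabels T k).toMeasure (hitting A ∩ hitting B)) := by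
          refine ENNReal.tsum_le_tsum fun t => ?_
          rw [mul_assoc, mul_assoc, ← mul_add, ← mul_add]
          gcongr
          by_cases ht : t ∈ A
          · have ht' : t ∉ B := Finset.disjoint_left.mp hAB ht
            simp only [Set.mem_inter_iff, insert_mem_hitting, ht, ht', true_or, true_and, false_or]
            simp [ht, ht']
          · by_cases ht' : t ∈ B
            · simp only [Set.mem_inter_iff, insert_mem_hitting, ht, ht', true_or, and_true,
                false_or]
              simp [ht, ht']
            · simp only [Set.mem_inter_iff, insert_mem_hitting, ht, ht', false_or]
              exact le_add_self
      _ = a * (drawLabels T k).toMeasure (hitting B) + b * (drawLabels T k).toMeasure (hitting A)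
            + (drawLabels T k).toMeasure (hitting A ∩ hitting B) := by
          rw [ENNReal.tsum_add, ENNReal.tsum_add, ENNReal.tsum_mul_right, ENNReal.tsum_mul_right,
            ENNReal.tsum_mul_right, PMF.tsum_coe, one_mul, ← sum_uniformLabel_eq_tsum,
            ← sum_uniformLabel_eq_tsum]
      _ ≤ a * (k * b) + b * (k * a) + (k : ℝ≥0∞) ^ 2 * (a * b) := by
          gcongr
          · exact drawLabels_hitting_le T k B
          · exact drawLabels_hitting_le T k A
      _ ≤ a * (k * b) + b * (k * a) + (k : ℝ≥0∞) ^ 2 * (a * b) + a * b := le_self_add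
      _ = _ := by push_cast; ring

theorem le_drawLabels_succ_hitting (T : ℕ+) (k : ℕ) (A : Finset ℕ+) :
    (∑ t ∈ A, uniformLabel T t) ≤ (drawLabels T (k + 1)).toMeasure (hitting A) := by
  rw [drawLabels_succ_apply, sum_uniformLabel_eq_tsum]
  refine ENNReal.tsum_le_tsum fun t => ?_
  gcongr
  by_cases ht : t ∈ A <;> simp [ht, insert_mem_hitting]

theorem edgeLaw_apply (ψ : PMF ℕ) (T : ℕ+) (D : Set (Finset ℕ+)) :
    (edgeLaw ψ T).toMeasure D = ∑' k, ψ k * (drawLabels T k).toMeasure D :=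
  PMF.toMeasure_bind_apply _ _ _ (Set.to_countable _).measurableSet

theorem uniformLabel_apply (T : ℕ+) (t : ℕ+) :
    uniformLabel T t = if t ∈ Finset.Icc 1 T then ((T : ℕ) : ℝ≥0∞)⁻¹ else 0 := by
  refine (PMF.uniformOfFinset_apply _ t).trans ?_
  simp

theorem sum_uniformLabel_le (T : ℕ+) (A : Finset ℕ+) :
    (∑ t ∈ A, uniformLabel T t) ≤ A.card * ((T : ℕ) : ℝ≥0∞)⁻¹ := by
  rw [← nsmul_eq_mul]
  refine Finset.sum_le_card_nsmul _ _ _ fun t _ => ?_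
  rw [uniformLabel_apply]
  split_ifs <;> simp

theorem sum_uniformLabel_of_subset (T : ℕ+) {A : Finset ℕ+} (hA : A ⊆ Finset.Icc 1 T) :
    (∑ t ∈ A, uniformLabel T t) = A.card * ((T : ℕ) : ℝ≥0∞)⁻¹ := by
  rw [← nsmul_eq_mul, ← Finset.sum_const]
  refine Finset.sum_congr rfl fun t ht => ?_
  rw [uniformLabel_apply, if_pos (hA ht)]

theorem edgeLaw_hitting_le_sum (ψ : PMF ℕ) (T : ℕ+) (A : Finset ℕ+) :
    (edgeLaw ψ T).toMeasure (hitting A) ≤ labelMoment ψ 1 * ∑ t ∈ A, uniformLabel T t := by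
  rw [edgeLaw_apply, labelMoment, ← ENNReal.tsum_mul_right]
  refine ENNReal.tsum_le_tsum fun k => ?_
  rw [mul_assoc, pow_one]
  gcongr
  exact drawLabels_hitting_le T k A

theorem edgeLaw_hitting_le (ψ : PMF ℕ) (T : ℕ+) (A : Finset ℕ+) :
    (edgeLaw ψ T).toMeasure (hitting A) ≤
      labelMoment ψ 1 * (A.card * ((T : ℕ) : ℝ≥0∞)⁻¹) := by
  refine (edgeLaw_hitting_le_sum ψ T A).trans ?_
  gcongr
  exact sum_uniformLabel_le T A

theorem edgeLaw_hitting_inter_le (ψ : PMF ℕ) (T : ℕ+) {A B : Finset ℕ+} (hAB : Disjoint A B) :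
    (edgeLaw ψ T).toMeasure (hitting A ∩ hitting B) ≤
      labelMoment ψ 2 * ((A.card * ((T : ℕ) : ℝ≥0∞)⁻¹) * (B.card * ((T : ℕ) : ℝ≥0∞)⁻¹)) := by
  rw [edgeLaw_apply, labelMoment, ← ENNReal.tsum_mul_right]
  refine ENNReal.tsum_le_tsum fun k => ?_
  rw [mul_assoc]
  gcongr
  refine (drawLabels_hitting_inter_le T k hAB).trans ?_
  gcongr <;> exact sum_uniformLabel_le T _

theorem le_edgeLaw_hitting (ψ : PMF ℕ) (T : ℕ+) {A : Finset ℕ+} (hA : A ⊆ Finset.Icc 1 T) (k : ℕ) :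
    ψ (k + 1) * (A.card * ((T : ℕ) : ℝ≥0∞)⁻¹) ≤ (edgeLaw ψ T).toMeasure (hitting A) := by
  rw [edgeLaw_apply, ← sum_uniformLabel_of_subset T hA]
  refine le_trans ?_ (ENNReal.le_tsum (k + 1))
  gcongr
  exact le_drawLabels_succ_hitting T k A

/-- All that the second moment argument needs from ψ, with constants independent of T. The lower
bound comes from one positive multiplicity k + 1 charged by ψ, which exists because the first moment
is positive. -/
theorem exists_edgeLaw_bounds {ψ : PMF ℕ} (hψ : IsLabelMultiplicity ψ) :
    ∃ c C : ℝ, 0 < c ∧ 1 ≤ C ∧ ∀ T : ℕ+,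
      (∀ A : Finset ℕ+, (edgeLaw ψ T).toMeasure.real (hitting A) ≤
        C * ((A.card : ℝ) / (T : ℕ))) ∧
      (∀ A B : Finset ℕ+, Disjoint A B → (edgeLaw ψ T).toMeasure.real (hitting A ∩ hitting B) ≤
        C * (((A.card : ℝ) / (T : ℕ)) * ((B.card : ℝ) / (T : ℕ)))) ∧
      (∀ A : Finset ℕ+, A ⊆ Finset.Icc 1 T →
        c * ((A.card : ℝ) / (T : ℕ)) ≤ (edgeLaw ψ T).toMeasure.real (hitting A)) := by
  obtain ⟨⟨h1, h1'⟩, -, h2'⟩ := hψ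
  obtain ⟨k, hk⟩ : ∃ k, ψ (k + 1) ≠ 0 := by
    by_contra! h
    refine h1.ne' (ENNReal.tsum_eq_zero.mpr fun k => ?_)
    cases k <;> simp [h]
  have key : ∀ (m : ℝ≥0∞) (A : Finset ℕ+) (T : ℕ+),
      (m * (A.card * ((T : ℕ) : ℝ≥0∞)⁻¹)).toReal = m.toReal * ((A.card : ℝ) / (T : ℕ)) := by
    intro m A T
    simp [div_eq_mul_inv]
  have hfin : ∀ (A : Finset ℕ+) (T : ℕ+), (A.card * ((T : ℕ) : ℝ≥0∞)⁻¹) ≠ ⊤ := fun A T =>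
    ENNReal.mul_ne_top (by simp) (by simp)
  refine ⟨(ψ (k + 1)).toReal, max 1 (max (labelMoment ψ 1).toReal (labelMoment ψ 2).toReal),
    ENNReal.toReal_pos hk (ψ.apply_ne_top _), le_max_left _ _, fun T => ⟨fun A => ?_,
      fun A B hAB => ?_, fun A hA => ?_⟩⟩
  · calc _ ≤ (labelMoment ψ 1).toReal * ((A.card : ℝ) / (T : ℕ)) := by
          rw [← key]
          exact ENNReal.toReal_mono (ENNReal.mul_ne_top h1'.ne (hfin A T)) (edgeLaw_hitting_le ψ T A)
      _ ≤ _ := by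
          gcongr
          exact (le_max_left _ _).trans (le_max_right _ _)
  · calc _ ≤ (labelMoment ψ 2).toReal * (((A.card : ℝ) / (T : ℕ)) * ((B.card : ℝ) / (T : ℕ))) := by
          rw [← mul_assoc, ← key, ← ENNReal.toReal_natCast B.card, ← ENNReal.toReal_natCast (T : ℕ),
            div_eq_mul_inv, ← ENNReal.toReal_inv, ← ENNReal.toReal_mul, ← ENNReal.toReal_mul,
            mul_assoc]
          exact ENNReal.toReal_mono (ENNReal.mul_ne_top h2'.ne
            (ENNReal.mul_ne_top (hfin A T) (hfin B T))) (edgeLaw_hitting_inter_le ψ T hAB)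
      _ ≤ _ := by
          gcongr
          exact (le_max_right _ _).trans (le_max_right _ _)
  · rw [← key]
    exact ENNReal.toReal_mono (measure_ne_top _ _) (le_edgeLaw_hitting ψ T hA k)

/-! ### Ranks in a finite strict order -/

/-- A finite strict order has a strictly monotone rank function with values below the size of its
longest chain. -/
theorem exists_rank_lt_chainHeight {α : Type*} [Finite α] {r : α → α → Prop}
    (hr : IsStrictOrder α r) {h : ℕ} (hh : Set.chainHeight Set.univ r = h) :
    ∃ f : α → ℕ, (∀ a, f a < h) ∧ ∀ a b, r a b → f a < f b := by
  have hfin : ∀ s : Set α, Set.chainHeight s r ≠ ⊤ := fun s =>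
    Set.chainHeight_ne_top_of_finite s r s.toFinite
  -- The rank of a is the height of the set strictly below a; a longest chain there is extended by a
  -- itself.
  have key : ∀ a (s : Set α), {x | r x a} ⊆ s → a ∈ s →
      Set.chainHeight {x | r x a} r + 1 ≤ Set.chainHeight s r := by
    intro a s hs ha
    obtain ⟨t, ht, hcard, hchain⟩ := Set.exists_eq_chainHeight_of_finite {x | r x a} r
      (Set.toFinite _)
    have hat : a ∉ t := fun h => irrefl a (ht h)
    rw [← hcard, ← Set.encard_insert_of_notMem hat]
    refine Set.encard_le_chainHeight_of_isChain _ _ (Set.insert_subset ha (ht.trans hs)) ?_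
    exact hchain.insert fun b hb _ => Or.inr (ht hb)
  refine ⟨fun a => (Set.chainHeight {x | r x a} r).toNat, fun a => ?_, fun a b hab => ?_⟩
  · have := key a Set.univ (Set.subset_univ _) (Set.mem_univ _)
    rw [hh, ← ENat.natCast_toNat (hfin {x | r x a})] at this
    exact_mod_cast this
  · have := key a {x | r x b} (fun x hx => _root_.trans hx hab) hab
    rw [← ENat.natCast_toNat (hfin {x | r x a}), ← ENat.natCast_toNat (hfin {x | r x b})] at this
    exact_mod_cast this

/-! ### Motifs as labelled embeddings -/

/-- The image of an edge under an injective vertex map. -/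
def edgeMap {V W : Type*} {H : SimpleGraph W} (φ : W ↪ V) :
    H.edgeSet ↪ (⊤ : SimpleGraph V).edgeSet :=
  SimpleGraph.Copy.mapEdgeSet
    ⟨⟨φ, fun {_ _} h => (SimpleGraph.top_adj _ _).mpr (φ.injective.ne h.ne)⟩, φ.injective⟩

theorem coe_edgeMap {V W : Type*} {H : SimpleGraph W} (φ : W ↪ V) (e : H.edgeSet) :
    (edgeMap φ e : Sym2 V) = Sym2.map φ e := rfl

/-- The host graph is complete, so every vertex injection yields a subgraph isomorphic to H and only
the labels constrain it. -/
theorem containsMotif_ofLabels_iff {V W : Type*} (L : (⊤ : SimpleGraph V).edgeSet → Finset ℕ+)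
    (H : SimpleGraph W) (P : H.edgeSet → H.edgeSet → Prop) (δ : ℝ) :
    (TemporalGraph.ofLabels L).ContainsMotif H P δ ↔
      ∃ (φ : W ↪ V) (t : H.edgeSet → ℕ+), (∀ e, t e ∈ L (edgeMap φ e)) ∧
        (∀ e f, P e f → t e < t f) ∧ ∀ e f, ((t e : ℕ) : ℝ) - ((t f : ℕ) : ℝ) < δ := by
  constructor
  · rintro ⟨S, lab, Φ, h1, h2, h3⟩
    have hlab : ∀ e : H.edgeSet, ∃ t : ℕ+, t ∈ L (S.hom.mapEdgeSet (Φ.mapEdgeSet e)) ∧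
        ((t : ℕ) : ℝ) = lab (Φ.mapEdgeSet e) := fun e =>
      Finset.mem_image.mp (h1 (Φ.mapEdgeSet e))
    choose t ht ht' using hlab
    refine ⟨⟨fun w => (Φ w : V), fun a b hab => Φ.injective (Subtype.ext hab)⟩, t, fun e => ?_,
      fun e f hef => ?_, fun e f => ?_⟩
    · refine (congrArg (fun f => t e ∈ L f) (Subtype.ext ?_)).mpr (ht e)
      obtain ⟨e, he⟩ := e
      induction e
      rfl
    · have := h2 e f hef
      rw [← ht', ← ht'] at this
      exact_mod_cast this
    · rw [ht', ht']
      exact h3 _ _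
  · rintro ⟨φ, t, h1, h2, h3⟩
    let c : SimpleGraph.Copy H (⊤ : SimpleGraph V) :=
      ⟨⟨φ, fun {_ _} h => (SimpleGraph.top_adj _ _).mpr (φ.injective.ne h.ne)⟩, φ.injective⟩
    let Φ : H ≃g c.toSubgraph.coe := c.isoToSubgraph
    have hΦ : ∀ e, t (Φ.mapEdgeSet.symm (Φ.mapEdgeSet e)) = t e := fun e => by
      rw [Equiv.symm_apply_apply]
    refine ⟨c.toSubgraph, fun e => ((t (Φ.mapEdgeSet.symm e) : ℕ) : ℝ), Φ, fun e => ?_,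
      fun e f hef => ?_, fun e f => h3 _ _⟩
    · obtain ⟨e, rfl⟩ := Φ.mapEdgeSet.surjective e
      refine Finset.mem_image.mpr ⟨t e, ?_, congrArg (fun s : ℕ+ => ((s : ℕ) : ℝ)) (hΦ e).symm⟩
      refine (congrArg (fun f => t e ∈ L f) (Subtype.ext ?_)).mpr (h1 e)
      obtain ⟨e, he⟩ := e
      induction e
      rfl
    · have := h2 e f hef
      rw [← hΦ e, ← hΦ f] at this
      exact Nat.cast_lt.mpr this

theorem TemporalGraph.ContainsMotif.coe_subgraph {V W : Type*}
    {L : (⊤ : SimpleGraph V).edgeSet → Finset ℕ+} {H : SimpleGraph W}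
    {P : H.edgeSet → H.edgeSet → Prop} {δ : ℝ}
    (h : (TemporalGraph.ofLabels L).ContainsMotif H P δ) (I : H.Subgraph) :
    (TemporalGraph.ofLabels L).ContainsMotif I.coe (fun _ _ => False) δ := by
  obtain ⟨φ, t, h1, -, h3⟩ := (containsMotif_ofLabels_iff _ _ _ _).mp h
  refine (containsMotif_ofLabels_iff _ _ _ _).mpr
    ⟨(Function.Embedding.subtype _).trans φ, fun e => t (I.hom.mapEdgeSet e), fun e => ?_,
      fun _ _ h => h.elim, fun _ _ => h3 _ _⟩
  refine (congrArg (fun f => t (I.hom.mapEdgeSet e) ∈ L f) (Subtype.ext ?_)).mpr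
    (h1 (I.hom.mapEdgeSet e))
  obtain ⟨e, he⟩ := e
  induction e
  rfl

/-! ### Second moment inequality -/

/-- The Chebyshev inequality for the number of occurring events among finitely many events that are
pairwise independent outside of a relation `dep`. -/
theorem measureReal_iInter_compl_mul_sq_le {Ω ι : Type*} [MeasurableSpace Ω] [Fintype ι]
    (μ : Measure Ω) [IsProbabilityMeasure μ] (A : ι → Set Ω) (hA : ∀ i, MeasurableSet (A i))
    (dep : ι → ι → Prop) [∀ i j, Decidable (dep i j)]
    (hdep : ∀ i j, ¬ dep i j → μ.real (A i ∩ A j) = μ.real (A i) * μ.real (A j)) :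
    μ.real (⋂ i, (A i)ᶜ) * (∑ i, μ.real (A i)) ^ 2 ≤
      ∑ i, ∑ j, if dep i j then μ.real (A i ∩ A j) else 0 := by
  classical
  set m := ∑ i, μ.real (A i) with hm
  set X : Ω → ℝ := fun ω => ∑ i, (A i).indicator 1 ω with hX
  have hint : ∀ s : Set Ω, MeasurableSet s → Integrable (s.indicator (1 : Ω → ℝ)) μ := fun s hs =>
    (integrable_const (1 : ℝ)).indicator hs
  have hXX : ∀ ω, X ω * X ω = ∑ i, ∑ j, (A i ∩ A j).indicator 1 ω := by
    intro ω
    simp only [hX, Finset.sum_mul_sum]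
    refine Finset.sum_congr rfl fun i _ => Finset.sum_congr rfl fun j _ => ?_
    by_cases hi : ω ∈ A i <;> by_cases hj : ω ∈ A j <;> simp [hi, hj]
  have hXint : Integrable X μ := integrable_finsetSum _ fun i _ => hint _ (hA i)
  have hXXint : Integrable (fun ω => X ω * X ω) μ := by
    simp only [hXX]
    exact integrable_finsetSum _ fun i _ => integrable_finsetSum _ fun j _ =>
      hint _ ((hA i).inter (hA j))
  have hEX : ∫ ω, X ω ∂μ = m := by
    rw [integral_finsetSum _ fun i _ => hint _ (hA i)]
    exact Finset.sum_congr rfl fun i _ => integral_indicator_one (hA i)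
  have hEXX : ∫ ω, X ω * X ω ∂μ = ∑ i, ∑ j, μ.real (A i ∩ A j) := by
    simp only [hXX]
    rw [integral_finsetSum _ fun i _ => integrable_finsetSum _ fun j _ =>
      hint _ ((hA i).inter (hA j))]
    refine Finset.sum_congr rfl fun i _ => ?_
    rw [integral_finsetSum _ fun j _ => hint _ ((hA i).inter (hA j))]
    exact Finset.sum_congr rfl fun j _ => integral_indicator_one ((hA i).inter (hA j))
  have hZ : MeasurableSet (⋂ i, (A i)ᶜ) := MeasurableSet.iInter fun i => (hA i).compl
  -- The right side is (X - m)², which equals m² where no event occurs; integrating bounds the left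
  -- side by the variance.
  have hle : ∀ ω, (⋂ i, (A i)ᶜ).indicator (1 : Ω → ℝ) ω * m ^ 2 ≤
      X ω * X ω - 2 * m * X ω + m ^ 2 := by
    intro ω
    by_cases hω : ω ∈ ⋂ i, (A i)ᶜ
    · have : X ω = 0 := Finset.sum_eq_zero fun i _ => by
        have : ω ∉ A i := Set.mem_iInter.mp hω i
        simp [this]
      simp [this, Set.indicator_of_mem hω]
    · rw [Set.indicator_of_notMem hω]
      nlinarith [sq_nonneg (X ω - m)]
  have h := integral_mono (μ := μ) ((hint _ hZ).mul_const (m ^ 2))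
    ((hXXint.sub (hXint.const_mul (2 * m))).add (integrable_const (m ^ 2))) hle
  rw [integral_mul_const, integral_indicator_one hZ] at h
  have h' : ∫ ω, (X ω * X ω - 2 * m * X ω + m ^ 2) ∂μ =
      (∑ i, ∑ j, μ.real (A i ∩ A j)) - m ^ 2 := by
    rw [integral_add (f := fun ω => X ω * X ω - 2 * m * X ω)
      (hXXint.sub (hXint.const_mul (2 * m))) (integrable_const (m ^ 2)),
      integral_sub hXXint (hXint.const_mul (2 * m)), integral_const_mul, hEX, hEXX]
    simp
    ring
  refine (h.trans_eq h').trans ?_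
  rw [hm, sq, Finset.sum_mul_sum, ← Finset.sum_sub_distrib]
  refine Finset.sum_le_sum fun i _ => ?_
  rw [← Finset.sum_sub_distrib]
  refine Finset.sum_le_sum fun j _ => ?_
  split_ifs with hij
  · have : 0 ≤ μ.real (A i) * μ.real (A j) := by positivity
    linarith
  · rw [hdep i j hij, sub_self]

/-! ### Windows of labels -/

/-- The set of `m` consecutive labels `a + 1, …, a + m`. -/
def labelWindow (a m : ℕ) : Finset ℕ+ := Finset.Ico (Nat.succPNat a) (Nat.succPNat (a + m))

theorem card_labelWindow (a m : ℕ) : (labelWindow a m).card = m := by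
  simp [labelWindow]

theorem mem_labelWindow {a m : ℕ} {t : ℕ+} :
    t ∈ labelWindow a m ↔ a < (t : ℕ) ∧ (t : ℕ) ≤ a + m := by
  rw [labelWindow, Finset.mem_Ico, ← PNat.coe_le_coe, ← PNat.coe_lt_coe, Nat.succPNat_coe,
    Nat.succPNat_coe]
  omega

/-! ### Edges shared by two embeddings -/

section Shared

variable {F E : Type*} [Fintype E]

open scoped Classical in
/-- The indices `e` whose coordinate `g e` is also a coordinate of the second map. -/
noncomputable def sharedIndices (g g' : E → F) : Finset E := {e | g e ∈ Set.range g'}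

theorem mem_sharedIndices {g g' : E → F} {e : E} :
    e ∈ sharedIndices g g' ↔ g e ∈ Set.range g' := by
  simp [sharedIndices]

theorem card_sharedIndices_comm {g g' : E → F} (hg : Function.Injective g)
    (hg' : Function.Injective g') : (sharedIndices g' g).card = (sharedIndices g g').card := by
  classical
  have : (sharedIndices g' g).image g' = (sharedIndices g g').image g := by
    ext f
    simp only [Finset.mem_image, mem_sharedIndices, Set.mem_range]
    grind
  rw [← Finset.card_image_of_injective _ hg', this, Finset.card_image_of_injective _ hg]

open scoped Classical in
theorem card_filter_notMem_range {g g' : E → F} (hg : Function.Injective g)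
    (hg' : Function.Injective g') :
    (Finset.univ.filter fun e => g' e ∉ Set.range g).card =
      Fintype.card E - (sharedIndices g g').card := by
  rw [← card_sharedIndices_comm hg hg', ← Finset.card_compl]
  congr 1
  ext e
  simp [sharedIndices]

end Shared

/-! ### Cylinder events under a product measure -/

section Box

variable {F X E : Type*} [Fintype F] [MeasurableSpace X] [Fintype E]
  (ν : Measure X) [IsProbabilityMeasure ν]

/-- The event that the coordinates `g e` lie in the sets `A e`. -/
def cylinderEvent (g : E → F) (A : E → Set X) : Set (F → X) := {L | ∀ e, L (g e) ∈ A e}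

theorem pi_cylinderEvent {g : E → F} (hg : Function.Injective g) (A : E → Set X) :
    Measure.pi (fun _ : F => ν) (cylinderEvent g A) = ∏ e, ν (A e) := by
  classical
  have hset : cylinderEvent g A = Set.univ.pi fun f => ⋂ (e) (_ : g e = f), A e := by
    ext L
    simp only [cylinderEvent, Set.mem_ofPred_eq, Set.mem_pi, Set.mem_univ, true_imp_iff,
      Set.mem_iInter]
    exact ⟨fun h f e he => he ▸ h e, fun h e => h _ e rfl⟩
  rw [hset, Measure.pi_pi,
    ← Finset.prod_subset (Finset.subset_univ (Finset.univ.map ⟨g, hg⟩)) fun f _ hf => ?_,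
    Finset.prod_map]
  · refine Finset.prod_congr rfl fun e _ => ?_
    congr 1
    ext x
    simp [hg.eq_iff]
  · have : ∀ e, g e ≠ f := fun e he => hf (by simp [← he])
    simp [this]

theorem pi_real_cylinderEvent {g : E → F} (hg : Function.Injective g) (A : E → Set X) :
    (Measure.pi fun _ : F => ν).real (cylinderEvent g A) = ∏ e, ν.real (A e) := by
  rw [measureReal_def, pi_cylinderEvent ν hg, ENNReal.toReal_prod]
  rfl

open scoped Classical in
-- The intersection is again a cylinder, indexed by E together with the coordinates that only g'
-- uses; a shared coordinate carries both constraints.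
theorem pi_real_cylinderEvent_inter {g g' : E → F} (hg : Function.Injective g)
    (hg' : Function.Injective g') (A A' : E → Set X) :
    (Measure.pi fun _ : F => ν).real (cylinderEvent g A ∩ cylinderEvent g' A') =
      (∏ e, ν.real (A e ∩ {x | ∀ e', g' e' = g e → x ∈ A' e'})) *
        ∏ e with g' e ∉ Set.range g, ν.real (A' e) := by
  have hset : cylinderEvent g A ∩ cylinderEvent g' A' =
      cylinderEvent (Sum.elim g fun e : {e // g' e ∉ Set.range g} => g' e)
        (Sum.elim (fun e => A e ∩ {x | ∀ e', g' e' = g e → x ∈ A' e'}) fun e => A' e) := by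
    ext L
    simp only [cylinderEvent, Set.mem_inter_iff, Set.mem_ofPred_eq, Sum.forall, Sum.elim_inl,
      Sum.elim_inr, Subtype.forall]
    constructor
    · rintro ⟨h, h'⟩
      exact ⟨fun e => ⟨h e, fun e' he' => he' ▸ h' e'⟩, fun e _ => h' e⟩
    · rintro ⟨h, h'⟩
      refine ⟨fun e => (h e).1, fun e' => ?_⟩
      by_cases he' : g' e' ∈ Set.range g
      · obtain ⟨e, he⟩ := he'
        exact he ▸ (h e).2 e' he.symm
      · exact h' e' he'
  have hinj : Function.Injective (Sum.elim g fun e : {e // g' e ∉ Set.range g} => g' e) := by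
    rintro (a | a) (b | b) hab
    · exact congrArg _ (hg hab)
    · exact (b.2 ⟨a, hab⟩).elim
    · exact (a.2 ⟨b, hab.symm⟩).elim
    · exact congrArg _ (Subtype.ext (hg' hab))
  rw [hset, pi_real_cylinderEvent ν hinj, Fintype.prod_sum_type]
  congr 1
  exact (Finset.prod_subtype _ (by simp) fun e => ν.real (A' e)).symm

theorem pi_real_cylinderEvent_inter_of_disjoint {g g' : E → F} (hg : Function.Injective g)
    (hg' : Function.Injective g') (A A' : E → Set X) (hd : ∀ e, g e ∉ Set.range g') :
    (Measure.pi fun _ : F => ν).real (cylinderEvent g A ∩ cylinderEvent g' A') =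
      (Measure.pi fun _ : F => ν).real (cylinderEvent g A) *
        (Measure.pi fun _ : F => ν).real (cylinderEvent g' A') := by
  classical
  rw [pi_real_cylinderEvent_inter ν hg hg', pi_real_cylinderEvent ν hg,
    pi_real_cylinderEvent ν hg']
  congr 1
  · refine Finset.prod_congr rfl fun e _ => ?_
    congr 1
    ext x
    exact ⟨fun h => h.1, fun h => ⟨h, fun e' he' => (hd e ⟨e', he'⟩).elim⟩⟩
  · rw [Finset.filter_true_of_mem]
    rintro e - ⟨e', he'⟩
    exact hd e' ⟨e, he'.symm⟩

/-- Each shared coordinate is charged only once. This serves pairs in the same block. -/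
theorem pi_real_cylinderEvent_inter_le_same {g g' : E → F} (hg : Function.Injective g)
    (hg' : Function.Injective g') (A A' : E → Set X) {q : ℝ} (hq : 0 ≤ q)
    (hA : ∀ e, ν.real (A e) ≤ q) (hA' : ∀ e, ν.real (A' e) ≤ q) :
    (Measure.pi fun _ : F => ν).real (cylinderEvent g A ∩ cylinderEvent g' A') ≤
      q ^ (2 * Fintype.card E - (sharedIndices g g').card) := by
  classical
  rw [pi_real_cylinderEvent_inter ν hg hg']
  have hj : (sharedIndices g g').card ≤ Fintype.card E := Finset.card_le_univ _
  have : 2 * Fintype.card E - (sharedIndices g g').card =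
    Fintype.card E + (Fintype.card E - (sharedIndices g g').card) := by omega
  rw [this, pow_add, ← card_filter_notMem_range hg hg']
  gcongr ?_ * ?_
  · rw [← Finset.card_univ, ← Finset.prod_const]
    exact Finset.prod_le_prod (fun _ _ => measureReal_nonneg) fun e _ =>
      (measureReal_mono Set.inter_subset_left).trans (hA e)
  · rw [← Finset.prod_const]
    exact Finset.prod_le_prod (fun _ _ => measureReal_nonneg) fun e _ => hA' e

/-- A shared coordinate still costs q² here, so sharing saves nothing. This serves pairs in
different blocks. -/
theorem pi_real_cylinderEvent_inter_le_sq {g g' : E → F} (hg : Function.Injective g)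
    (hg' : Function.Injective g') (A A' : E → Set X) {q : ℝ} (hq : 0 ≤ q)
    (hA : ∀ e, ν.real (A e) ≤ q) (hA' : ∀ e, ν.real (A' e) ≤ q)
    (hAA' : ∀ e e', ν.real (A e ∩ A' e') ≤ q ^ 2) :
    (Measure.pi fun _ : F => ν).real (cylinderEvent g A ∩ cylinderEvent g' A') ≤
      q ^ (2 * Fintype.card E) := by
  classical
  rw [pi_real_cylinderEvent_inter ν hg hg']
  have hj : (sharedIndices g g').card ≤ Fintype.card E := Finset.card_le_univ _
  have hsplit : q ^ (2 * Fintype.card E) =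
      (∏ e, if e ∈ sharedIndices g g' then q ^ 2 else q) *
        ∏ e with g' e ∉ Set.range g, q := by
    have : ∀ e, (if e ∈ sharedIndices g g' then q ^ 2 else q) =
        q * if e ∈ sharedIndices g g' then q else 1 := fun e => by split_ifs <;> ring
    simp only [this]
    rw [Finset.prod_mul_distrib, Finset.prod_ite_mem, Finset.univ_inter, Finset.prod_const,
      Finset.prod_const, Finset.prod_const, card_filter_notMem_range hg hg', ← pow_add, ← pow_add,
      Finset.card_univ]
    congr 1
    omega
  rw [hsplit]
  gcongr ?_ * ?_
  · refine Finset.prod_le_prod (fun _ _ => measureReal_nonneg) fun e _ => ?_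
    split_ifs with he
    · obtain ⟨e', he'⟩ := mem_sharedIndices.mp he
      exact (measureReal_mono (Set.inter_subset_inter_right _ fun x
        (hx : ∀ e', g' e' = g e → x ∈ A' e') => hx e' he')).trans
        (hAA' e e')
    · exact (measureReal_mono Set.inter_subset_left).trans (hA e)
  · exact Finset.prod_le_prod (fun _ _ => measureReal_nonneg) fun e _ => hA' e

end Box

/-! ### First moment bound -/

/-- Union bound over the embedding and the exact label s of the anchor edge e₀. Summing over s costs
only a factor `labelMoment ψ 1`, so just the other edges pay for proximity. -/
theorem pi_containsMotif_le {V W : Type*} [Fintype V] [DecidableEq V] [Finite W]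
    {H : SimpleGraph W} (e₀ : H.edgeSet) (P : H.edgeSet → H.edgeSet → Prop) (ψ : PMF ℕ) (T : ℕ+)
    (b : ℕ) :
    Measure.pi (fun _ : (⊤ : SimpleGraph V).edgeSet => (edgeLaw ψ T).toMeasure)
        {L | (TemporalGraph.ofLabels L).ContainsMotif H P b} ≤
      (Fintype.card V : ℝ≥0∞) ^ Nat.card W * (labelMoment ψ 1 *
        (labelMoment ψ 1 * ((2 * b : ℕ) * ((T : ℕ) : ℝ≥0∞)⁻¹)) ^ (H.edgeSet.ncard - 1)) := by
  classical
  have := Fintype.ofFinite W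
  have := Fintype.ofFinite H.edgeSet
  set μ := Measure.pi (fun _ : (⊤ : SimpleGraph V).edgeSet => (edgeLaw ψ T).toMeasure)
  set q : ℝ≥0∞ := labelMoment ψ 1 * ((2 * b : ℕ) * ((T : ℕ) : ℝ≥0∞)⁻¹) with hq
  -- If s < b, the truncated difference is 0 and the window {1, …, 2b} still contains every positive
  -- label within distance less than b of s.
  let A : ℕ+ → H.edgeSet → Set (Finset ℕ+) := fun s e =>
    if e = e₀ then hitting {s} else hitting (labelWindow (s - b) (2 * b))
  have hsub : {L | (TemporalGraph.ofLabels L).ContainsMotif H P b} ⊆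
      ⋃ (φ : W ↪ V) (s : ℕ+), cylinderEvent (edgeMap φ) (A s) := by
    intro L hL
    obtain ⟨φ, t, h1, -, h3⟩ := (containsMotif_ofLabels_iff _ _ _ _).mp hL
    refine Set.mem_iUnion₂.mpr ⟨φ, t e₀, fun e => ?_⟩
    by_cases he : e = e₀
    · simp only [A, he, if_true]
      exact ⟨t e₀, h1 e₀, by simp⟩
    · simp only [A, he, if_false]
      refine ⟨t e, h1 e, mem_labelWindow.mpr ?_⟩
      have ha : (t e : ℕ) < b + t e₀ := by
        have := h3 e e₀
        rw [sub_lt_iff_lt_add] at this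
        exact_mod_cast this
      have hb : (t e₀ : ℕ) < b + t e := by
        have := h3 e₀ e
        rw [sub_lt_iff_lt_add] at this
        exact_mod_cast this
      have := (t e).pos
      omega
  have hprod : ∀ (φ : W ↪ V) (s : ℕ+), μ (cylinderEvent (edgeMap φ) (A s)) ≤
      labelMoment ψ 1 * uniformLabel T s * q ^ (H.edgeSet.ncard - 1) := by
    intro φ s
    rw [pi_cylinderEvent _ (edgeMap φ).injective, ← Finset.mul_prod_erase _ _ (Finset.mem_univ e₀)]
    gcongr ?_ * ?_
    · simp only [A, if_true]
      simpa using edgeLaw_hitting_le_sum ψ T {s}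
    · rw [← Nat.card_coe_set_eq, Nat.card_eq_fintype_card, ← Finset.card_univ,
        ← Finset.card_erase_of_mem (Finset.mem_univ e₀)]
      refine Finset.prod_le_pow_card _ _ _ fun e he => ?_
      simp only [A, (Finset.mem_erase.mp he).1, if_false]
      simpa only [card_labelWindow] using
        edgeLaw_hitting_le ψ T (labelWindow (s - b) (2 * b))
  calc μ {L | (TemporalGraph.ofLabels L).ContainsMotif H P b}
      ≤ μ (⋃ (φ : W ↪ V) (s : ℕ+), cylinderEvent (edgeMap φ) (A s)) := measure_mono hsub
    _ ≤ ∑ φ : W ↪ V, μ (⋃ s : ℕ+, cylinderEvent (edgeMap φ) (A s)) := by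
        simpa using measure_iUnion_fintype_le μ _
    _ ≤ ∑ φ : W ↪ V, labelMoment ψ 1 * q ^ (H.edgeSet.ncard - 1) := by
        refine Finset.sum_le_sum fun φ _ => (measure_iUnion_le _).trans ?_
        refine (ENNReal.tsum_le_tsum (hprod φ)).trans_eq ?_
        rw [ENNReal.tsum_mul_right, ENNReal.tsum_mul_left, PMF.tsum_coe, mul_one]
    _ ≤ _ := by
        rw [Finset.sum_const, nsmul_eq_mul]
        gcongr
        rw [Finset.card_univ, Fintype.card_embedding_eq, Nat.card_eq_fintype_card]
        exact_mod_cast Nat.descFactorial_le_pow _ _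

/-! ### Counting overlapping pairs of embeddings -/

section Counting

variable {V W : Type*} [Fintype V] [Fintype W] {H : SimpleGraph W}

open scoped Classical in
/-- The vertices incident to one of the edges in `J`. -/
noncomputable def incidentVertices (J : Finset H.edgeSet) : Finset W :=
  {w | ∃ e ∈ J, w ∈ (e : Sym2 W)}

theorem mem_incidentVertices {J : Finset H.edgeSet} {w : W} :
    w ∈ incidentVertices J ↔ ∃ e ∈ J, w ∈ (e : Sym2 W) := by
  simp [incidentVertices]

open scoped Classical in
/-- The number of pairs of embeddings whose images share exactly the edges of `J`. -/
theorem card_sharedIndices_eq_le [Fintype H.edgeSet] (J : Finset H.edgeSet) :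
    ({x | sharedIndices (edgeMap (H := H) x.1) (edgeMap x.2) = J} :
        Finset ((W ↪ V) × (W ↪ V))).card ≤
      Fintype.card W ^ Fintype.card W * (Fintype.card V ^ Fintype.card W *
        Fintype.card V ^ (Fintype.card W - (incidentVertices J).card)) := by
  -- For a vertex of a shared edge, g names the vertex that the second embedding sends to the same
  -- place.
  have hex : ∀ x : (W ↪ V) × (W ↪ V), ∃ g : W → W,
      sharedIndices (edgeMap (H := H) x.1) (edgeMap x.2) = J →
        ∀ w ∈ incidentVertices J, x.2 (g w) = x.1 w := by
    intro x
    by_cases hx : sharedIndices (edgeMap (H := H) x.1) (edgeMap x.2) = J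
    · have : ∀ w, ∃ u, w ∈ incidentVertices J → x.2 u = x.1 w := by
        intro w
        by_cases hw : w ∈ incidentVertices J
        · obtain ⟨e, he, hwe⟩ := mem_incidentVertices.mp hw
          rw [← hx, mem_sharedIndices] at he
          obtain ⟨e', he'⟩ := he
          have hmem : x.1 w ∈ Sym2.map x.2 (e' : Sym2 W) := by
            rw [← coe_edgeMap, he', coe_edgeMap]
            exact Sym2.mem_map.mpr ⟨w, hwe, rfl⟩
          obtain ⟨u, -, hu⟩ := Sym2.mem_map.mp hmem
          exact ⟨u, fun _ => hu⟩
        · exact ⟨w, fun h => (hw h).elim⟩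
      choose g hg using this
      exact ⟨g, fun _ w => hg w⟩
    · exact ⟨id, fun h => (hx h).elim⟩
  choose g hg using hex
  -- This code determines the pair: on incident vertices the first embedding is the second composed
  -- with g, elsewhere it is recorded.
  let F : (W ↪ V) × (W ↪ V) → (W → W) × (W → V) × ({w // w ∉ incidentVertices J} → V) :=
    fun x => (g x, x.2, fun w => x.1 w)
  have hcard : Fintype.card ((W → W) × (W → V) × ({w // w ∉ incidentVertices J} → V)) =
      Fintype.card W ^ Fintype.card W * (Fintype.card V ^ Fintype.card W *
        Fintype.card V ^ (Fintype.card W - (incidentVertices J).card)) := by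
    rw [Fintype.card_prod, Fintype.card_prod, Fintype.card_fun, Fintype.card_fun, Fintype.card_fun]
    congr 3
    rw [Fintype.card_subtype_compl]
    simp
  rw [← hcard, ← Finset.card_univ]
  refine Finset.card_le_card_of_injOn F (fun _ _ => Finset.mem_coe.mpr (Finset.mem_univ _)) ?_
  intro x hx y hy hxy
  have hx := (Finset.mem_filter.mp (Finset.mem_coe.mp hx)).2
  have hy := (Finset.mem_filter.mp (Finset.mem_coe.mp hy)).2
  obtain ⟨h1, h2, h3⟩ : g x = g y ∧ (x.2 : W → V) = y.2 ∧
      ∀ w : {w // w ∉ incidentVertices J}, x.1 w = y.1 w := by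
    simpa [F, funext_iff] using hxy
  refine Prod.ext (DFunLike.ext _ _ fun w => ?_) (DFunLike.coe_injective h2)
  by_cases hw : w ∈ incidentVertices J
  · rw [← hg x hx w hw, ← hg y hy w hw, h1, h2]
  · exact h3 ⟨w, hw⟩

end Counting

/-! ### Second moment bound -/

section SecondMoment

variable {W : Type*} {H : SimpleGraph W}

/-- The event that, after embedding `H` by `φ`, every edge `e` has a label in the sub-window of
rank `r e` of the `w`-th window of length `b`. -/
def windowEvent {V : Type*} (r : H.edgeSet → ℕ) (b m : ℕ) (φ : W ↪ V) (w : ℕ) :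
    Set ((⊤ : SimpleGraph V).edgeSet → Finset ℕ+) :=
  cylinderEvent (edgeMap φ) fun e => hitting (labelWindow (w * b + r e * m) m)

theorem containsMotif_of_mem_windowEvent {V : Type*} {r : H.edgeSet → ℕ} {h b m w : ℕ} {φ : W ↪ V}
    {P : H.edgeSet → H.edgeSet → Prop} (hrh : ∀ e, r e < h) (hr : ∀ e f, P e f → r e < r f)
    (hm : h * m ≤ b) {L : (⊤ : SimpleGraph V).edgeSet → Finset ℕ+}
    (hL : L ∈ windowEvent r b m φ w) : (TemporalGraph.ofLabels L).ContainsMotif H P b := by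
  choose t ht ht' using hL
  refine (containsMotif_ofLabels_iff _ _ _ _).mpr ⟨φ, t, ht, fun e f hef => ?_, fun e f => ?_⟩
  · have he := (mem_labelWindow.mp (ht' e)).2
    have hf := (mem_labelWindow.mp (ht' f)).1
    have : (r e + 1) * m ≤ r f * m := Nat.mul_le_mul_right m (hr e f hef)
    rw [add_mul, one_mul] at this
    exact PNat.coe_lt_coe _ _ |>.mp (by omega)
  · have he := (mem_labelWindow.mp (ht' e)).2
    have hf := (mem_labelWindow.mp (ht' f)).1
    have : (r e + 1) * m ≤ h * m := Nat.mul_le_mul_right m (hrh e)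
    rw [add_mul, one_mul] at this
    rw [sub_lt_iff_lt_add]
    have : (t e : ℕ) < b + t f := by omega
    exact_mod_cast this

theorem disjoint_labelWindow {h b m w w' i j : ℕ} (hi : i < h) (hj : j < h) (hm : h * m ≤ b)
    (hw : w ≠ w') : Disjoint (labelWindow (w * b + i * m) m) (labelWindow (w' * b + j * m) m) := by
  have hi : (i + 1) * m ≤ h * m := Nat.mul_le_mul_right m hi
  have hj : (j + 1) * m ≤ h * m := Nat.mul_le_mul_right m hj
  rw [add_mul, one_mul] at hi hj
  refine Finset.disjoint_left.mpr fun t ht ht' => ?_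
  rw [mem_labelWindow] at ht ht'
  rcases hw.lt_or_gt with hlt | hlt
  · have : (w + 1) * b ≤ w' * b := Nat.mul_le_mul_right b hlt
    rw [add_mul, one_mul] at this
    omega
  · have : (w' + 1) * b ≤ w * b := Nat.mul_le_mul_right b hlt
    rw [add_mul, one_mul] at this
    omega

theorem labelWindow_subset_Icc {h b m w i : ℕ} {T : ℕ+} (hi : i < h) (hm : h * m ≤ b)
    (hw : w < (T : ℕ) / b) : labelWindow (w * b + i * m) m ⊆ Finset.Icc 1 T := by
  intro t ht
  rw [mem_labelWindow] at ht
  refine Finset.mem_Icc.mpr ⟨one_le, ?_⟩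
  have hi : (i + 1) * m ≤ h * m := Nat.mul_le_mul_right m hi
  have hw : (w + 1) * b ≤ T := (Nat.mul_le_mul_right b hw).trans (Nat.div_mul_le_self _ _)
  rw [add_mul, one_mul] at hi hw
  exact PNat.coe_le_coe _ _ |>.mp (by omega)

variable [Fintype W] [Fintype H.edgeSet]

/-- Pairs are grouped by their set J of shared edges; ι indexes the blocks, giving |ι| equal pairs
of blocks and at most |ι|² different ones. -/
theorem sum_dependent_pairs_le {V : Type*} [Fintype V] [DecidableEq V] (μ : Measure
      ((⊤ : SimpleGraph V).edgeSet → Finset ℕ+)) {ι : Type*} [Fintype ι] [DecidableEq ι]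
    (A : (W ↪ V) × ι → Set ((⊤ : SimpleGraph V).edgeSet → Finset ℕ+)) {q : ℝ} (hq : 0 ≤ q)
    (hsame : ∀ φ φ' w, μ.real (A (φ, w) ∩ A (φ', w)) ≤ q ^ (2 * Fintype.card H.edgeSet -
      (sharedIndices (edgeMap (H := H) φ) (edgeMap φ')).card))
    (hdiff : ∀ φ φ' w w', w ≠ w' → μ.real (A (φ, w) ∩ A (φ', w')) ≤
      q ^ (2 * Fintype.card H.edgeSet))
    [∀ i j : (W ↪ V) × ι,
      Decidable (sharedIndices (edgeMap (H := H) i.1) (edgeMap j.1)).Nonempty] :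
    (∑ i, ∑ j, if (sharedIndices (edgeMap (H := H) i.1) (edgeMap j.1)).Nonempty then
        μ.real (A i ∩ A j) else 0) ≤
      ∑ J : Finset H.edgeSet with J.Nonempty,
        (Fintype.card W : ℝ) ^ Fintype.card W * ((Fintype.card V : ℝ) ^ Fintype.card W *
          (Fintype.card V : ℝ) ^ (Fintype.card W - (incidentVertices J).card)) *
        (Fintype.card ι * q ^ (2 * Fintype.card H.edgeSet - J.card) +
          (Fintype.card ι : ℝ) ^ 2 * q ^ (2 * Fintype.card H.edgeSet)) := by
  classical
  set S : (W ↪ V) × (W ↪ V) → Finset H.edgeSet := fun x =>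
    sharedIndices (edgeMap (H := H) x.1) (edgeMap x.2) with hS
  set g : Finset H.edgeSet → ℝ := fun J =>
    Fintype.card ι * q ^ (2 * Fintype.card H.edgeSet - J.card) +
      (Fintype.card ι : ℝ) ^ 2 * q ^ (2 * Fintype.card H.edgeSet) with hg
  have hg0 : ∀ J, 0 ≤ g J := fun J => by positivity
  calc (∑ i, ∑ j, if (sharedIndices (edgeMap (H := H) i.1) (edgeMap j.1)).Nonempty then
        μ.real (A i ∩ A j) else 0)
      = ∑ φ, ∑ φ', ∑ w, ∑ w', if (S (φ, φ')).Nonempty then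
          μ.real (A (φ, w) ∩ A (φ', w')) else 0 := by
        rw [Fintype.sum_prod_type]
        refine Finset.sum_congr rfl fun φ _ => ?_
        simp only [Fintype.sum_prod_type]
        rw [Finset.sum_comm]
        exact Finset.sum_congr rfl fun _ _ => Finset.sum_congr rfl fun _ _ =>
          Finset.sum_congr rfl fun _ _ => by congr
    _ ≤ ∑ φ, ∑ φ', if (S (φ, φ')).Nonempty then g (S (φ, φ')) else 0 := by
        refine Finset.sum_le_sum fun φ _ => Finset.sum_le_sum fun φ' _ => ?_
        split_ifs with hdep
        · calc ∑ w, ∑ w', μ.real (A (φ, w) ∩ A (φ', w'))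
              ≤ ∑ w : ι, ∑ w' : ι, ((if w = w' then
                  q ^ (2 * Fintype.card H.edgeSet - (S (φ, φ')).card) else 0) +
                  q ^ (2 * Fintype.card H.edgeSet)) := by
                refine Finset.sum_le_sum fun w _ => Finset.sum_le_sum fun w' _ => ?_
                split_ifs with hw
                · subst hw
                  exact (hsame φ φ' w).trans (le_add_of_nonneg_right (by positivity))
                · rw [zero_add]
                  exact hdiff φ φ' w w' hw
            _ = g (S (φ, φ')) := by
                simp only [hg, Finset.sum_add_distrib, Finset.sum_ite_eq, Finset.mem_univ, if_true,
                  Finset.sum_const, nsmul_eq_mul, Finset.card_univ]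
                ring
        · simp
    _ = ∑ x, if (S x).Nonempty then g (S x) else 0 := by rw [Fintype.sum_prod_type]
    _ = ∑ J, ∑ x with S x = J, if (S x).Nonempty then g (S x) else 0 :=
        (Finset.sum_fiberwise _ _ _).symm
    _ = ∑ J : Finset H.edgeSet with J.Nonempty,
          (({x | S x = J} : Finset ((W ↪ V) × (W ↪ V))).card : ℝ) * g J := by
        rw [Finset.sum_filter]
        refine Finset.sum_congr rfl fun J _ => ?_
        rw [Finset.sum_congr rfl fun x hx => by rw [(Finset.mem_filter.mp hx).2]]
        split_ifs <;> simp
    _ ≤ _ := by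
        refine Finset.sum_le_sum fun J _ => mul_le_mul_of_nonneg_right ?_ (hg0 J)
        exact_mod_cast card_sharedIndices_eq_le (V := V) J

/-- Factors the squared mean out of the contribution of J, after the block count K has been absorbed
by Kp ≤ 1. -/
theorem pow_mul_pow_sub_mul_add_eq {n p : ℝ} (hn : 0 < n) (hp : 0 < p) {v u e j : ℕ}
    (hu : u ≤ v) (hj : 1 ≤ j)
    (hje : j ≤ e) :
    n ^ v * n ^ (v - u) * (p ^ (2 * e - j - 1) + p ^ (2 * e - 2)) =
      (n ^ v * p ^ (e - 1)) ^ 2 * ((n ^ u * p ^ (j - 1))⁻¹ + (n ^ u)⁻¹) := by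
  obtain ⟨a, rfl⟩ := Nat.exists_eq_add_of_le hu
  obtain ⟨i, rfl⟩ := Nat.exists_eq_add_of_le hj
  obtain ⟨d, rfl⟩ := Nat.exists_eq_add_of_le hje
  rw [show u + a - u = a by omega, show 2 * (1 + i + d) - (1 + i) - 1 = i + 2 * d by omega,
    show 2 * (1 + i + d) - 2 = 2 * i + 2 * d by omega, show 1 + i + d - 1 = i + d by omega,
    show 1 + i - 1 = i by omega]
  field_simp
  ring

/-- The second moment bound for the probability that a motif is missing. -/
theorem exists_pi_not_containsMotif_le {P : H.edgeSet → H.edgeSet → Prop}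
    (hP : IsStrictOrder H.edgeSet P) [Nonempty H.edgeSet] {ψ : PMF ℕ}
    (hψ : IsLabelMultiplicity ψ) :
    ∃ D : ℝ, ∀ (n b : ℕ) (T : ℕ+), Set.chainHeight Set.univ P ≤ b → b ≤ T →
      2 * Fintype.card W ≤ n →
      (Measure.pi fun _ : (⊤ : SimpleGraph (Fin n)).edgeSet => (edgeLaw ψ T).toMeasure).real
        {L | ¬ (TemporalGraph.ofLabels L).ContainsMotif H P b} ≤
      D * ∑ J : Finset H.edgeSet with J.Nonempty,
        (((n : ℝ) ^ (incidentVertices J).card * ((b : ℝ) / (T : ℕ)) ^ (J.card - 1))⁻¹ +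
          ((n : ℝ) ^ (incidentVertices J).card)⁻¹) := by
  classical
  obtain ⟨c, C, hc, hC, hbounds⟩ := exists_edgeLaw_bounds hψ
  obtain ⟨h, hh⟩ := ENat.ne_top_iff_exists.mp
    (Set.chainHeight_ne_top_of_finite (Set.univ : Set H.edgeSet) P (Set.toFinite _))
  obtain ⟨r, hrh, hr⟩ := exists_rank_lt_chainHeight hP hh.symm
  have hh0 : 0 < h := (Nat.zero_le _).trans_lt (hrh (Classical.arbitrary _))
  set v := Fintype.card W with hv
  set E := Fintype.card H.edgeSet with hE
  have hE1 : 1 ≤ E := Fintype.card_pos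
  -- The factors are the losses in the mean: at least (n/2)^v injections, Kp ≥ 1/2, and sub-windows
  -- of relative length at least p/(2h).
  set c' : ℝ := (1 / 2) ^ v * (1 / 2) * (c / (2 * h)) ^ E with hc'
  have hc'0 : 0 < c' := by positivity
  refine ⟨v ^ v * C ^ (2 * E) / c' ^ 2, fun n b T hb hbT hn => ?_⟩
  rw [← hh] at hb
  have hb : h ≤ b := by exact_mod_cast hb
  have hb0 : 0 < b := hh0.trans_le hb
  have hv1 : 1 ≤ v := by
    obtain ⟨e, he⟩ := Classical.arbitrary H.edgeSet
    induction e with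
    | h x y => exact Fintype.card_pos_iff.mpr ⟨x⟩
  have hn0 : (0 : ℝ) < n := by exact_mod_cast (by omega : 0 < n)
  have hTpos : (0 : ℝ) < (T : ℕ) := by exact_mod_cast T.pos
  set p : ℝ := (b : ℝ) / (T : ℕ) with hp
  have hp0 : 0 < p := by positivity
  set m := b / h with hm
  have hmb : h * m ≤ b := Nat.mul_div_le b h
  set K := (T : ℕ) / b with hK
  set ν := (edgeLaw ψ T).toMeasure with hν
  set μ := Measure.pi fun _ : (⊤ : SimpleGraph (Fin n)).edgeSet => ν with hμ
  obtain ⟨hup, hjoint, hlow⟩ := hbounds T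
  have hmp : (m : ℝ) / (T : ℕ) ≤ p := by
    have : m ≤ b := Nat.div_le_self _ _
    rw [hp]
    gcongr
  -- Since b ≥ h, rounding b/h down loses at most a factor 2; this is where the height hypothesis
  -- enters.
  have hpm : p / (2 * h) ≤ (m : ℝ) / (T : ℕ) := by
    have h1 : b ≤ 2 * h * m := by
      have := Nat.lt_div_mul_add (a := b) hh0
      have h2 : h * 1 ≤ h * m := Nat.mul_le_mul_left h ((Nat.one_le_div_iff hh0).mpr hb)
      rw [← hm, mul_comm] at this
      rw [mul_assoc]
      omega
    have h1 : (b : ℝ) ≤ 2 * h * m := by exact_mod_cast h1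
    rw [hp, div_div, mul_comm, ← div_div]
    gcongr
    rw [div_le_iff₀ (by positivity)]
    linarith
  have hKp : K * p ≤ 1 := by
    have : (K : ℝ) * b ≤ (T : ℕ) := by exact_mod_cast Nat.div_mul_le_self _ _
    rw [hp, ← mul_div_assoc]
    exact (div_le_one hTpos).mpr this
  have hpK : 1 / 2 ≤ K * p := by
    have h1 : (T : ℕ) ≤ 2 * (K * b) := by
      have := Nat.lt_div_mul_add (a := (T : ℕ)) hb0
      rw [← hK] at this
      have h2 : 1 * b ≤ K * b := Nat.mul_le_mul_right b ((Nat.one_le_div_iff hb0).mpr hbT)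
      omega
    have h1 : ((T : ℕ) : ℝ) ≤ 2 * (K * b) := by exact_mod_cast h1
    rw [hp, ← mul_div_assoc, le_div_iff₀ hTpos]
    linarith
  set q : ℝ := C * p with hq
  have hq0 : 0 ≤ q := by positivity
  let ev : (W ↪ Fin n) × Fin K → Set ((⊤ : SimpleGraph (Fin n)).edgeSet → Finset ℕ+) :=
    fun i => windowEvent r b m i.1 i.2
  have hq_le : ∀ (w : ℕ) (e : H.edgeSet),
      ν.real (hitting (labelWindow (w * b + r e * m) m)) ≤ q := fun w e => by
    refine (hup _).trans ?_
    rw [card_labelWindow, hq]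
    gcongr
  have hmeas : ∀ s : Set ((⊤ : SimpleGraph (Fin n)).edgeSet → Finset ℕ+), MeasurableSet s :=
    fun s => s.to_countable.measurableSet
  have hcheb := measureReal_iInter_compl_mul_sq_le μ ev (fun i => hmeas _)
    (fun i j => (sharedIndices (edgeMap (H := H) i.1) (edgeMap j.1)).Nonempty) fun i j hij =>
      pi_real_cylinderEvent_inter_of_disjoint ν (edgeMap i.1).injective (edgeMap j.1).injective _ _
        fun e he => hij ⟨e, mem_sharedIndices.mpr he⟩
  have hsum := sum_dependent_pairs_le (H := H) μ ev hq0
    (fun φ φ' w => pi_real_cylinderEvent_inter_le_same ν (edgeMap φ).injective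
      (edgeMap φ').injective _ _ hq0 (hq_le w) (hq_le w))
    (fun φ φ' w w' hw => pi_real_cylinderEvent_inter_le_sq ν (edgeMap φ).injective
      (edgeMap φ').injective _ _ hq0 (hq_le w) (hq_le w') fun e e' => by
        refine (hjoint _ _ (disjoint_labelWindow (hrh e) (hrh e') hmb
          (fun h => hw (Fin.ext h)))).trans ?_
        rw [card_labelWindow, card_labelWindow, hq, mul_pow, ← sq]
        -- The normalization C ≥ 1 lets the joint bound be read as q².
        have : C ≤ C ^ 2 := le_self_pow₀ hC two_ne_zero
        gcongr)
  have hmean : c' * (n ^ v * p ^ (E - 1)) ≤ ∑ i, μ.real (ev i) := by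
    have hev : ∀ i, (c / (2 * h) * p) ^ E ≤ μ.real (ev i) := by
      intro i
      refine le_of_le_of_eq ?_ (pi_real_cylinderEvent ν (edgeMap i.1).injective _).symm
      rw [hE, ← Finset.card_univ, ← Finset.prod_const]
      refine Finset.prod_le_prod (fun _ _ => by positivity) fun e _ => ?_
      refine le_trans ?_ (hlow _ (labelWindow_subset_Icc (hrh e) hmb i.2.2))
      rw [card_labelWindow, div_mul_eq_mul_div, mul_div_assoc]
      gcongr
    have hcard : ((n : ℝ) / 2) ^ v ≤ Fintype.card (W ↪ Fin n) := by
      rw [Fintype.card_embedding_eq, Fintype.card_fin]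
      refine le_trans ?_ (Nat.cast_le.mpr (Nat.pow_sub_le_descFactorial n v))
      push_cast
      gcongr
      have : n ≤ 2 * (n + 1 - v) := by omega
      have : (n : ℝ) ≤ 2 * ((n + 1 - v : ℕ) : ℝ) := by exact_mod_cast this
      linarith
    calc c' * (n ^ v * p ^ (E - 1))
        = (n / 2) ^ v * ((1 / 2) * ((c / (2 * h)) ^ E * p ^ (E - 1))) := by
          rw [hc', div_pow (n : ℝ), div_pow (1 : ℝ), one_pow]
          ring
      _ ≤ Fintype.card (W ↪ Fin n) * ((K * p) * ((c / (2 * h)) ^ E * p ^ (E - 1))) := by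
          gcongr
      _ = Fintype.card ((W ↪ Fin n) × Fin K) * (c / (2 * h) * p) ^ E := by
          rw [mul_pow, ← Nat.sub_add_cancel hE1, pow_succ p, Nat.add_sub_cancel, Fintype.card_prod,
            Fintype.card_fin]
          push_cast
          ring
      _ ≤ ∑ i, μ.real (ev i) := by
          rw [← nsmul_eq_mul, ← Finset.card_univ]
          exact Finset.card_nsmul_le_sum _ _ _ fun i _ => hev i
  have hsub : {L | ¬ (TemporalGraph.ofLabels L).ContainsMotif H P b} ⊆ ⋂ i, (ev i)ᶜ := by
    intro L hL
    refine Set.mem_iInter.mpr fun i hi => hL ?_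
    exact containsMotif_of_mem_windowEvent hrh hr hmb hi
  set Z := μ.real {L | ¬ (TemporalGraph.ofLabels L).ContainsMotif H P b} with hZ
  have hZ_le : Z ≤ μ.real (⋂ i, (ev i)ᶜ) := measureReal_mono hsub
  set M : ℝ := n ^ v * p ^ (E - 1) with hM
  have hM0 : 0 < M := by positivity
  have hmain : Z * (c' * M) ^ 2 ≤ v ^ v * C ^ (2 * E) * (M ^ 2 *
      ∑ J : Finset H.edgeSet with J.Nonempty,
        (((n : ℝ) ^ (incidentVertices J).card * p ^ (J.card - 1))⁻¹ +
          ((n : ℝ) ^ (incidentVertices J).card)⁻¹)) := by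
    calc Z * (c' * M) ^ 2 ≤ μ.real (⋂ i, (ev i)ᶜ) * (∑ i, μ.real (ev i)) ^ 2 := by gcongr
      _ ≤ _ := hcheb
      _ ≤ _ := hsum
      _ ≤ _ := by
          rw [Finset.mul_sum, Finset.mul_sum]
          refine Finset.sum_le_sum fun J hJ => ?_
          have hJ1 : 1 ≤ J.card := Finset.card_pos.mpr (Finset.mem_filter.mp hJ).2
          have hJE : J.card ≤ E := Finset.card_le_univ _
          rw [← pow_mul_pow_sub_mul_add_eq hn0 hp0 (Finset.card_le_univ _) hJ1 hJE, Fintype.card_fin,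
            Fintype.card_fin, ← hv, mul_assoc, mul_assoc ((v : ℝ) ^ v), mul_left_comm (C ^ (2 * E))]
          gcongr
          rw [mul_add]
          gcongr ?_ + ?_
          · calc (K : ℝ) * q ^ (2 * E - J.card)
                = C ^ (2 * E - J.card) * ((K * p) * p ^ (2 * E - J.card - 1)) := by
                  have : 2 * E - J.card = (2 * E - J.card - 1) + 1 := by omega
                  rw [hq, mul_pow, this, pow_succ p, Nat.add_sub_cancel]
                  ring
              _ ≤ C ^ (2 * E) * (1 * p ^ (2 * E - J.card - 1)) := by
                  gcongr
                  omega
              _ = _ := by rw [one_mul]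
          · calc (K : ℝ) ^ 2 * q ^ (2 * E) = C ^ (2 * E) * ((K * p) ^ 2 * p ^ (2 * E - 2)) := by
                  have : 2 * E = (2 * E - 2) + 2 := by omega
                  rw [hq, mul_pow, mul_pow, mul_assoc, ← pow_add, add_comm 2, ← this]
                  ring
              _ ≤ C ^ (2 * E) * (1 ^ 2 * p ^ (2 * E - 2)) := by gcongr
              _ = _ := by rw [one_pow, one_mul]
  rw [div_mul_eq_mul_div, le_div_iff₀ (by positivity)]
  refine le_of_mul_le_mul_right ?_ (by positivity : 0 < M ^ 2)
  calc _ = Z * (c' * M) ^ 2 := by ring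
    _ ≤ _ := hmain
    _ = _ := by ring

end SecondMoment

/-! ### The sparsity as an attained minimum -/

section Sparsity

variable {W : Type*} {H : SimpleGraph W}

theorem exists_subgraph_sparsity_eq [Finite W] (hH : 2 ≤ H.edgeSet.ncard) :
    ∃ I : H.Subgraph, 2 ≤ I.edgeSet.ncard ∧
      sparsity H = (I.verts.ncard : ℝ) / ((I.edgeSet.ncard : ℝ) - 1) := by
  have hfin : {x : ℝ | ∃ I : H.Subgraph, 2 ≤ I.edgeSet.ncard ∧
      x = (I.verts.ncard : ℝ) / ((I.edgeSet.ncard : ℝ) - 1)}.Finite := by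
    have : Finite H.Subgraph := Finite.of_injective
      (fun I : H.Subgraph => (I.verts, I.Adj)) fun I J h =>
        SimpleGraph.Subgraph.ext (congrArg Prod.fst h) (congrArg Prod.snd h)
    refine (Set.finite_range fun I : H.Subgraph =>
      (I.verts.ncard : ℝ) / ((I.edgeSet.ncard : ℝ) - 1)).subset ?_
    rintro x ⟨I, -, rfl⟩
    exact ⟨I, rfl⟩
  have hne : {x : ℝ | ∃ I : H.Subgraph, 2 ≤ I.edgeSet.ncard ∧
      x = (I.verts.ncard : ℝ) / ((I.edgeSet.ncard : ℝ) - 1)}.Nonempty :=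
    ⟨_, ⊤, by simpa using hH, rfl⟩
  exact hne.csInf_mem hfin

theorem sparsity_le {I : H.Subgraph} (hI : 2 ≤ I.edgeSet.ncard) :
    sparsity H ≤ (I.verts.ncard : ℝ) / ((I.edgeSet.ncard : ℝ) - 1) := by
  refine csInf_le ⟨0, ?_⟩ ⟨I, hI, rfl⟩
  rintro x ⟨J, hJ, rfl⟩
  have : (2 : ℝ) ≤ J.edgeSet.ncard := by exact_mod_cast hJ
  exact div_nonneg (by positivity) (by linarith)

/-- Minimality is applied to the subgraph formed by J and its endpoints. For at most one edge the
truncated `J.card - 1` is 0. -/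
theorem sparsity_mul_le [Fintype W] (J : Finset H.edgeSet) :
    sparsity H * (J.card - 1 : ℕ) ≤ (incidentVertices J).card := by
  rcases le_or_gt J.card 1 with hJ | hJ
  · rw [Nat.sub_eq_zero_of_le hJ]
    simp
  let I : H.Subgraph :=
    { verts := incidentVertices J
      Adj := fun a b => ∃ e ∈ J, (e : Sym2 W) = s(a, b)
      adj_sub := by
        rintro a b ⟨e, -, he⟩
        exact SimpleGraph.mem_edgeSet _ |>.mp (he ▸ e.2)
      edge_vert := by
        rintro a b ⟨e, heJ, he⟩
        exact Finset.mem_coe.mpr (mem_incidentVertices.mpr ⟨e, heJ, he ▸ Sym2.mem_mk_left a b⟩)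
      symm := ⟨by
        rintro a b ⟨e, heJ, he⟩
        exact ⟨e, heJ, he.trans Sym2.eq_swap⟩⟩ }
  have hedge : I.edgeSet = Subtype.val '' (J : Set H.edgeSet) := by
    ext e
    induction e with
    | h a b => simp [I]
  have hcard : I.edgeSet.ncard = J.card := by
    rw [hedge, Set.ncard_image_of_injective _ Subtype.val_injective, Set.ncard_coe_finset]
  have hverts : I.verts.ncard = (incidentVertices J).card := Set.ncard_coe_finset _
  have h := sparsity_le (I := I) (by omega)
  have h1 : (1 : ℝ) < J.card := by exact_mod_cast hJ
  rw [hcard, hverts, le_div_iff₀ (by linarith)] at h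
  rwa [Nat.cast_sub hJ.le, Nat.cast_one]

end Sparsity

/-! ### Passage to the limit -/

section Limits

theorem doublyRandom_apply (n : ℕ) (ψ : PMF ℕ) (T : ℕ+) (S : Set (TemporalGraph (Fin n))) :
    doublyRandom (Fin n) ψ T S =
      Measure.pi (fun _ : (⊤ : SimpleGraph (Fin n)).edgeSet => (edgeLaw ψ T).toMeasure)
        {L | TemporalGraph.ofLabels L ∈ S} :=
  Measure.map_apply (fun _ _ => (Set.to_countable _).measurableSet) trivial

instance isProbabilityMeasure_doublyRandom (n : ℕ) (ψ : PMF ℕ) (T : ℕ+) :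
    IsProbabilityMeasure (doublyRandom (Fin n) ψ T) :=
  ⟨by rw [doublyRandom_apply]; simp⟩

theorem tendsto_measure_compl_one {Ω : ℕ → Type*} [∀ n, MeasurableSpace (Ω n)]
    (μ : ∀ n, Measure (Ω n)) [∀ n, IsProbabilityMeasure (μ n)] (S : ∀ n, Set (Ω n))
    (hS : ∀ n, MeasurableSet (S n)) (h : Tendsto (fun n => μ n (S n)) atTop (𝓝 0)) :
    Tendsto (fun n => μ n (S n)ᶜ) atTop (𝓝 1) := by
  simp only [fun n => prob_compl_eq_one_sub (μ := μ n) (hS n)]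
  simpa using ENNReal.Tendsto.sub tendsto_const_nhds h (Or.inl ENNReal.one_ne_top)

variable {W : Type*} [Finite W] {H : SimpleGraph W}

theorem tendsto_containsMotif_zero (hH : 2 ≤ H.edgeSet.ncard)
    (P : H.edgeSet → H.edgeSet → Prop) {ψ : PMF ℕ} (hψ : IsLabelMultiplicity ψ)
    (β : ℕ → ℕ) (T : ℕ → ℕ+)
    (hlittle : (fun n : ℕ => (β n : ℝ) / ((T n : ℕ) : ℝ)) =o[atTop]
      (fun n : ℕ => (n : ℝ) ^ (-sparsity H))) :
    Tendsto (fun n : ℕ => doublyRandom (Fin n) ψ (T n) {G | G.ContainsMotif H P (β n : ℝ)})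
      atTop (𝓝 0) := by
  obtain ⟨I, hI, hρ⟩ := exists_subgraph_sparsity_eq hH
  set ρ := sparsity H
  set k := I.edgeSet.ncard - 1 with hk
  have hcardI : I.coe.edgeSet.ncard = I.edgeSet.ncard := by
    rw [← I.image_coe_edgeSet_coe, Set.ncard_image_of_injective _
      (Sym2.map.injective Subtype.val_injective)]
  obtain ⟨e₀⟩ : Nonempty I.coe.edgeSet := by
    refine Set.Nonempty.to_subtype (Set.nonempty_of_ncard_ne_zero ?_)
    omega
  set M := labelMoment ψ 1 with hM
  have hMtop : M ≠ ⊤ := hψ.1.2.ne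
  have hle : ∀ n, doublyRandom (Fin n) ψ (T n) {G | G.ContainsMotif H P (β n : ℝ)} ≤
      (n : ℝ≥0∞) ^ I.verts.ncard *
        (M * (M * ((2 * β n : ℕ) * ((T n : ℕ) : ℝ≥0∞)⁻¹)) ^ k) := by
    intro n
    rw [doublyRandom_apply]
    refine (measure_mono fun L hL => ?_).trans ((pi_containsMotif_le (V := Fin n) e₀
      (fun _ _ => False) ψ (T n) (β n)).trans_eq ?_)
    · exact TemporalGraph.ContainsMotif.coe_subgraph hL I
    · rw [hcardI, Fintype.card_fin, Nat.card_coe_set_eq]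
  -- Because I attains the minimum, this is an equality, and n^|V_I| is exactly (n^ρ)^k.
  have hkρ : ρ * k = I.verts.ncard := by
    have h2 : (2 : ℝ) ≤ I.edgeSet.ncard := by exact_mod_cast hI
    rw [hρ, hk, Nat.cast_sub (by omega), Nat.cast_one]
    exact div_mul_cancel₀ _ (by linarith)
  have hlim : Tendsto (fun n : ℕ => M.toReal * (2 * M.toReal) ^ k *
      (((β n : ℝ) / ((T n : ℕ) : ℝ)) / (n : ℝ) ^ (-ρ)) ^ k) atTop (𝓝 0) := by
    have := ((hlittle.tendsto_div_nhds_zero.pow k).const_mul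
      (M.toReal * (2 * M.toReal) ^ k))
    rwa [zero_pow (by omega), mul_zero] at this
  have hlim' : Tendsto (fun n : ℕ => ENNReal.ofReal (M.toReal * (2 * M.toReal) ^ k *
      (((β n : ℝ) / ((T n : ℕ) : ℝ)) / (n : ℝ) ^ (-ρ)) ^ k)) atTop (𝓝 0) := by
    simpa using ENNReal.tendsto_ofReal hlim
  refine tendsto_of_tendsto_of_tendsto_of_le_of_le' tendsto_const_nhds hlim'
    (Eventually.of_forall fun _ => zero_le) ?_
  filter_upwards [eventually_gt_atTop 0] with n hn
  refine (hle n).trans_eq ?_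
  have hn0 : (0 : ℝ) < n := by exact_mod_cast hn
  rw [← ENNReal.ofReal_toReal (a := (n : ℝ≥0∞) ^ I.verts.ncard *
        (M * (M * ((2 * β n : ℕ) * ((T n : ℕ) : ℝ≥0∞)⁻¹)) ^ k))]
  · congr 1
    have hpow : (n : ℝ) ^ I.verts.ncard = ((n : ℝ) ^ ρ) ^ k := by
      rw [← Real.rpow_natCast, ← hkρ, Real.rpow_mul hn0.le, Real.rpow_natCast]
    simp only [ENNReal.toReal_mul, ENNReal.toReal_pow, ENNReal.toReal_natCast, ENNReal.toReal_inv]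
    rw [hpow, Real.rpow_neg hn0.le, div_inv_eq_mul]
    push_cast
    rw [mul_pow, mul_pow, mul_pow, mul_pow, mul_pow, div_pow, inv_pow]
    ring
  · refine ENNReal.mul_ne_top (by simp) (ENNReal.mul_ne_top hMtop (ENNReal.pow_ne_top
      (ENNReal.mul_ne_top hMtop (ENNReal.mul_ne_top (ENNReal.natCast_ne_top _)
      (by simp)))))

theorem tendsto_not_containsMotif_zero (hH : 2 ≤ H.edgeSet.ncard)
    {P : H.edgeSet → H.edgeSet → Prop} (hP : IsStrictOrder H.edgeSet P)
    {ψ : PMF ℕ} (hψ : IsLabelMultiplicity ψ) (β : ℕ → ℕ) (T : ℕ → ℕ+)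
    (hβ : ∀ᶠ n in atTop, Set.chainHeight Set.univ P ≤ (β n : ℕ∞))
    (hT : ∀ n, β n ≤ (T n : ℕ))
    (hlittle : (fun n : ℕ => (n : ℝ) ^ (-sparsity H)) =o[atTop]
      (fun n : ℕ => (β n : ℝ) / ((T n : ℕ) : ℝ))) :
    Tendsto (fun n : ℕ => doublyRandom (Fin n) ψ (T n) {G | ¬ G.ContainsMotif H P (β n : ℝ)})
      atTop (𝓝 0) := by
  classical
  have := Fintype.ofFinite W
  have := Fintype.ofFinite H.edgeSet
  have : Nonempty H.edgeSet := Set.Nonempty.to_subtype (Set.nonempty_of_ncard_ne_zero (by omega))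
  obtain ⟨D, hD⟩ := exists_pi_not_containsMotif_le hP hψ
  set p : ℕ → ℝ := fun n => (β n : ℝ) / ((T n : ℕ) : ℝ) with hp
  have hinv : ∀ u : ℕ, u ≠ 0 → Tendsto (fun n : ℕ => ((n : ℝ) ^ u)⁻¹) atTop (𝓝 0) := fun u hu =>
    ((tendsto_pow_atTop hu).comp tendsto_natCast_atTop_atTop).inv_tendsto_atTop
  have hterm : ∀ J : Finset H.edgeSet, J.Nonempty → Tendsto (fun n : ℕ =>
      (((n : ℝ) ^ (incidentVertices J).card * p n ^ (J.card - 1))⁻¹ +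
          ((n : ℝ) ^ (incidentVertices J).card)⁻¹)) atTop (𝓝 0) := by
    intro J hJ
    have hu : (incidentVertices J).card ≠ 0 := by
      obtain ⟨e, he⟩ := hJ
      refine Finset.card_ne_zero.mpr ⟨(e : Sym2 W).out.1, mem_incidentVertices.mpr ⟨e, he, ?_⟩⟩
      exact Sym2.out_fst_mem _
    rw [← add_zero (0 : ℝ)]
    refine Tendsto.add ?_ (hinv _ hu)
    -- With a single shared edge no power of p remains and n^(-u) tends to 0 by itself; otherwise u
    -- ≥ ρ(|J| - 1) bounds the term by (n^(-ρ)/p)^(|J|-1).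
    by_cases hk : J.card - 1 = 0
    · simpa [hk] using hinv _ hu
    have hlim : Tendsto (fun n : ℕ => ((n : ℝ) ^ (-sparsity H) / p n) ^ (J.card - 1))
        atTop (𝓝 0) := by
      have := hlittle.tendsto_div_nhds_zero.pow (J.card - 1)
      rwa [zero_pow hk] at this
    refine tendsto_of_tendsto_of_tendsto_of_le_of_le' tendsto_const_nhds hlim
      (Eventually.of_forall fun n => by positivity) ?_
    filter_upwards [eventually_gt_atTop 0] with n hn
    have hn1 : (1 : ℝ) ≤ n := by exact_mod_cast hn
    have hn0 : (0 : ℝ) < n := by linarith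
    have hpow : ((n : ℝ) ^ sparsity H) ^ (J.card - 1) ≤ (n : ℝ) ^ (incidentVertices J).card := by
      rw [← Real.rpow_natCast, ← Real.rpow_natCast, ← Real.rpow_mul hn0.le]
      exact Real.rpow_le_rpow_of_exponent_le hn1 (sparsity_mul_le J)
    have hp0 : 0 ≤ p n := by positivity
    generalize p n = y at hp0 ⊢
    rw [mul_inv, Real.rpow_neg hn0.le, div_pow, inv_pow, div_eq_mul_inv]
    have : 0 < (n : ℝ) ^ sparsity H := Real.rpow_pos_of_pos hn0 _
    gcongr
  have hlim : Tendsto (fun n : ℕ => ENNReal.ofReal (D * ∑ J : Finset H.edgeSet with J.Nonempty,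
      (((n : ℝ) ^ (incidentVertices J).card * p n ^ (J.card - 1))⁻¹ +
          ((n : ℝ) ^ (incidentVertices J).card)⁻¹))) atTop (𝓝 0) := by
    have := (tendsto_finsetSum (Finset.univ.filter fun J : Finset H.edgeSet => J.Nonempty)
      fun J hJ => hterm J (Finset.mem_filter.mp hJ).2).const_mul D
    simpa using ENNReal.tendsto_ofReal this
  refine tendsto_of_tendsto_of_tendsto_of_le_of_le' tendsto_const_nhds hlim
    (Eventually.of_forall fun _ => zero_le) ?_
  filter_upwards [hβ, eventually_ge_atTop (2 * Fintype.card W)] with n hn hn'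
  rw [doublyRandom_apply]
  refine ENNReal.le_ofReal_iff_toReal_le (measure_ne_top _ _) ?_ |>.mpr
    (hD n (β n) (T n) hn (hT n) hn')
  exact measureReal_nonneg.trans (hD n (β n) (T n) hn (hT n) hn')

end Limits

theorem mainTheorem2 {W : Type*} [Finite W] (H : SimpleGraph W) (hH : 2 ≤ H.edgeSet.ncard)
    (P : H.edgeSet → H.edgeSet → Prop) (hP : IsStrictOrder H.edgeSet P)
    (ψ : PMF ℕ) (hψ : IsLabelMultiplicity ψ)
    (β : ℕ → ℕ) (T : ℕ → ℕ+)
    (hβ : ∃ n₀ > 0, ∀ n ≥ n₀, Set.chainHeight Set.univ P ≤ (β n : ℕ∞))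
    (hT : ∀ n, β n ≤ (T n : ℕ)) :
    ((fun n : ℕ => (n : ℝ) ^ (-sparsity H)) =o[atTop]
        (fun n : ℕ => (β n : ℝ) / ((T n : ℕ) : ℝ)) →
      Tendsto (fun n : ℕ => doublyRandom (Fin n) ψ (T n) {G | G.ContainsMotif H P (β n : ℝ)})
        atTop (𝓝 1)) ∧
    ((fun n : ℕ => (β n : ℝ) / ((T n : ℕ) : ℝ)) =o[atTop]
        (fun n : ℕ => (n : ℝ) ^ (-sparsity H)) →
      Tendsto (fun n : ℕ => doublyRandom (Fin n) ψ (T n) {G | ¬ G.ContainsMotif H P (β n : ℝ)})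
        atTop (𝓝 1)) := by
  refine ⟨fun h => ?_, fun h => ?_⟩
  · obtain ⟨n₀, -, hn₀⟩ := hβ
    have h0 := tendsto_not_containsMotif_zero hH hP hψ β T
      (eventually_atTop.mpr ⟨n₀, hn₀⟩) hT h
    have h1 := tendsto_measure_compl_one (fun n => doublyRandom (Fin n) ψ (T n)) _
      (fun _ => trivial) h0
    simpa only [← Set.compl_ofPred, compl_compl] using h1
  · exact tendsto_measure_compl_one (fun n => doublyRandom (Fin n) ψ (T n)) _ (fun _ => trivial)
      (tendsto_containsMotif_zero hH P hψ β T h)
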